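/- Let $p$ be a prime, let $\mathbb{F}_q$ be a finite field of characteristic $p$, and let $\mathbb{F}_q(t)\langle\partial\rangle$ be the ring of linear differential operators $\sum_i f_i\partial^i$ with coefficients $f_i\in\mathbb{F}_q(t)$, where $\partial f=f\partial+\frac{\mathrm{d}f}{\mathrm{d}t}$ for all $f\in\mathbb{F}_q(t)$. For an operator $L$, let $\mathcal{D}_L=\mathbb{F}_q(t)\langle\partial\rangle/\mathbb{F}_q(t)\langle\partial\rangle L$ be the left quotient module, and let the $p$-curvature $\psi_p^L$ be the $\mathbb{F}_q(t)$-linear endomorphism of $\mathcal{D}_L$ given by left multiplication by $\partial^p$. For $L\neq 0$ the $\mathbb{F}_q(t)$-vector space $\mathcal{D}_L$ has finite dimension, and we write $\chi(\psi_p^L)$ for the characteristic polynomial of $\psi_p^L$. Let $L_1,L_2\in\mathbb{F}_q(t)\langle\partial\rangle$ be nonzero operators such that, for $i=1,2$, every irreducible polynomial $N\in\mathbb{F}_q(t^p)[Y]$ which divides $\chi(\psi_p^{L_i})$ is separable. Then $\mathcal{D}_{L_1}$ and $\mathcal{D}_{L_2}$ are isomorphic as left $\mathbb{F}_q(t)\langle\partial\rangle$-modules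 if and only if $\psi_p^{L_1}$ and $\psi_p^{L_2}$ are equivalent (similar) as $\mathbb{F}_q(t)$-linear endomorphisms, that is, if and only if there is an $\mathbb{F}_q(t)$-linear isomorphism $e:\mathcal{D}_{L_1}\to\mathcal{D}_{L_2}$ with $e\circ\psi_p^{L_1}=\psi_p^{L_2}\circ e$. -/

import Mathlib

open Polynomial

open scoped Differential

noncomputable section

/-- The differential ring structure given by an additive map with the Leibniz rule. -/
@[reducible]
def Differential.ofLeibniz {R : Type*} [CommRing R] (d : R → R) (h : ∀ x y, d (x + y) = d x + d y)
    (h' : ∀ x y, d (x * y) = x * d y + y * d x) : Differential R where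
  deriv := Derivation.mk' (AddMonoidHom.mk' d h).toIntLinearMap h'

theorem Differential.deriv_inv_pow_char {K : Type*} [Field K] [Differential K] (p : ℕ) [CharP K p]
    (x : K) : ((x ^ p)⁻¹)′ = 0 := by
  rw [Derivation.leibniz_inv, Derivation.leibniz_pow]
  simp

theorem Differential.deriv_mul_of_const {K : Type*} [CommRing K] [Differential K] {c : K}
    (hc : c′ = 0) (x : K) : (c * x)′ = c * x′ := by
  simp [hc]

/-! ## The derivation `d/dt` on the field of rational functions -/

namespace RatFunc

variable {F : Type*} [Field F]

/-- The derivative `d/dt` of a rational function, by the quotient rule. -/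
def ddt (f : RatFunc F) : RatFunc F :=
  (algebraMap F[X] (RatFunc F) (derivative f.num) * algebraMap F[X] (RatFunc F) f.denom
    - algebraMap F[X] (RatFunc F) f.num * algebraMap F[X] (RatFunc F) (derivative f.denom))
    / algebraMap F[X] (RatFunc F) f.denom ^ 2

theorem ddt_div (a b : F[X]) (hb : b ≠ 0) :
    ddt (algebraMap F[X] (RatFunc F) a / algebraMap F[X] (RatFunc F) b)
      = (algebraMap F[X] (RatFunc F) (derivative a) * algebraMap F[X] (RatFunc F) b
        - algebraMap F[X] (RatFunc F) a * algebraMap F[X] (RatFunc F) (derivative b))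
        / algebraMap F[X] (RatFunc F) b ^ 2 := by
  set f := algebraMap F[X] (RatFunc F) a / algebraMap F[X] (RatFunc F) b with hf
  have hd : f.denom ≠ 0 := f.denom_ne_zero
  have hb' : algebraMap F[X] (RatFunc F) b ≠ 0 := RatFunc.algebraMap_ne_zero hb
  have hd' : algebraMap F[X] (RatFunc F) f.denom ≠ 0 := RatFunc.algebraMap_ne_zero hd
  have h1 : f.num * b = a * f.denom := by
    apply RatFunc.algebraMap_injective F
    rw [map_mul, map_mul]
    have := f.num_div_denom
    rw [hf, div_eq_div_iff hd' hb', ← hf] at this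
    exact this
  have h2 : derivative f.num * b + f.num * derivative b
      = derivative a * f.denom + a * derivative f.denom := by
    rw [← derivative_mul, ← derivative_mul, h1]
  have h1' := congrArg (algebraMap F[X] (RatFunc F)) h1
  have h2' := congrArg (algebraMap F[X] (RatFunc F)) h2
  simp only [map_mul, map_add] at h1' h2'
  unfold ddt
  rw [div_eq_div_iff (pow_ne_zero 2 hd') (pow_ne_zero 2 hb')]
  generalize algebraMap F[X] (RatFunc F) (derivative f.num) = n' at *
  generalize algebraMap F[X] (RatFunc F) (derivative f.denom) = d' at *
  generalize algebraMap F[X] (RatFunc F) f.num = n at *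
  generalize algebraMap F[X] (RatFunc F) f.denom = d at *
  generalize algebraMap F[X] (RatFunc F) (derivative b) = b' at *
  generalize algebraMap F[X] (RatFunc F) b = b at *
  generalize algebraMap F[X] (RatFunc F) (derivative a) = a' at *
  generalize algebraMap F[X] (RatFunc F) a = a at *
  linear_combination (b * d) * h2' - (b' * d + d' * b) * h1'

theorem exists_eq_div (f : RatFunc F) : ∃ a b : F[X], b ≠ 0 ∧
    f = algebraMap F[X] (RatFunc F) a / algebraMap F[X] (RatFunc F) b :=
  ⟨f.num, f.denom, f.denom_ne_zero, f.num_div_denom.symm⟩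

theorem ddt_add (f g : RatFunc F) : ddt (f + g) = ddt f + ddt g := by
  obtain ⟨a, b, hb, rfl⟩ := exists_eq_div f
  obtain ⟨c, d, hd, rfl⟩ := exists_eq_div g
  have hb' : algebraMap F[X] (RatFunc F) b ≠ 0 := RatFunc.algebraMap_ne_zero hb
  have hd' : algebraMap F[X] (RatFunc F) d ≠ 0 := RatFunc.algebraMap_ne_zero hd
  rw [div_add_div _ _ hb' hd', ddt_div _ _ hb, ddt_div _ _ hd]
  simp only [← map_mul, ← map_add]
  rw [ddt_div _ _ (mul_ne_zero hb hd)]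
  simp only [derivative_mul, map_mul, map_add]
  field_simp
  ring

theorem ddt_mul (f g : RatFunc F) : ddt (f * g) = f * ddt g + g * ddt f := by
  obtain ⟨a, b, hb, rfl⟩ := exists_eq_div f
  obtain ⟨c, d, hd, rfl⟩ := exists_eq_div g
  have hb' : algebraMap F[X] (RatFunc F) b ≠ 0 := RatFunc.algebraMap_ne_zero hb
  have hd' : algebraMap F[X] (RatFunc F) d ≠ 0 := RatFunc.algebraMap_ne_zero hd
  rw [div_mul_div_comm, ddt_div _ _ hb, ddt_div _ _ hd]
  simp only [← map_mul]
  rw [ddt_div _ _ (mul_ne_zero hb hd)]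
  simp only [derivative_mul, map_mul, map_add]
  field_simp
  ring

/-- `F(t)` as a differential field, with the derivation `d/dt`. -/
instance instDifferential : Differential (RatFunc F) :=
  Differential.ofLeibniz ddt ddt_add ddt_mul

theorem deriv_eq_ddt (f : RatFunc F) : f′ = ddt f := rfl

theorem deriv_algebraMap_poly (a : F[X]) :
    (algebraMap F[X] (RatFunc F) a)′ = algebraMap F[X] (RatFunc F) (derivative a) := by
  have := ddt_div a 1 one_ne_zero
  simpa [deriv_eq_ddt] using this

theorem iterate_deriv_algebraMap_poly (n : ℕ) (a : F[X]) :
    (fun f : RatFunc F => f′)^[n] (algebraMap F[X] (RatFunc F) a)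
      = algebraMap F[X] (RatFunc F) (derivative^[n] a) := by
  induction n generalizing a with
  | zero => rfl
  | succ n ih => rw [Function.iterate_succ_apply, deriv_algebraMap_poly, ih,
      Function.iterate_succ_apply]

/-- In characteristic `p` the `p`-th iterate of `d/dt` vanishes on `F(t)`. -/
theorem iterate_deriv_char (p : ℕ) [Fact p.Prime] [CharP F p] (f : RatFunc F) :
    (fun f : RatFunc F => f′)^[p] f = 0 := by
  obtain ⟨a, b, hb, rfl⟩ := exists_eq_div f
  have hb' : algebraMap F[X] (RatFunc F) b ≠ 0 := RatFunc.algebraMap_ne_zero hb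
  have hp : 1 ≤ p := (Fact.out : p.Prime).one_lt.le
  have : CharP (RatFunc F) p := charP_of_injective_algebraMap (algebraMap F (RatFunc F)).injective p
  set B := algebraMap F[X] (RatFunc F) b
  set c := (B ^ p)⁻¹ with hc
  have hc' : c′ = 0 := Differential.deriv_inv_pow_char p B
  have key : ∀ (n : ℕ) (g : RatFunc F), (fun f : RatFunc F => f′)^[n] (c * g)
      = c * (fun f : RatFunc F => f′)^[n] g := by
    intro n
    induction n with
    | zero => intro g; rfl
    | succ n ih =>
      intro g
      rw [Function.iterate_succ_apply, Function.iterate_succ_apply, ← ih]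
      congr 1
      exact Differential.deriv_mul_of_const hc' g
  have hf : algebraMap F[X] (RatFunc F) a / B
      = c * algebraMap F[X] (RatFunc F) (a * b ^ (p - 1)) := by
    rw [hc, map_mul, map_pow, div_eq_iff hb']
    change _ = (B ^ p)⁻¹ * (_ * B ^ (p - 1)) * B
    have : B ^ (p - 1) * B = B ^ p := by rw [← pow_succ, Nat.sub_add_cancel hp]
    rw [mul_assoc, mul_assoc, this]
    field_simp
  rw [hf, key, iterate_deriv_algebraMap_poly, iterate_derivative_eq_factorial_smul_sum]
  have : ((p.factorial : ℕ) : F[X]) = 0 :=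
    (CharP.cast_eq_zero_iff F[X] p _).2 (Nat.dvd_factorial (by omega) le_rfl)
  rw [nsmul_eq_mul, this]
  simp

end RatFunc

/-! ## The ring `K⟨∂⟩` of linear differential operators -/

/-- Linear differential operators over a differential ring `K`: the left `K`-module of formal
expressions `∑ fᵢ ∂ⁱ`, stored as the polynomial with coefficients `fᵢ`. The multiplication, defined
below, is the one with `∂ f = f ∂ + f′`, not that of the polynomial ring. -/
def DiffOp (K : Type*) [CommRing K] : Type _ := K[X]

namespace DiffOp

section Ring

variable {K : Type*} [CommRing K]

instance : AddCommGroup (DiffOp K) := inferInstanceAs (AddCommGroup K[X])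

instance : Module K (DiffOp K) := inferInstanceAs (Module K K[X])

/-- The polynomial with the same coefficients. -/
def toPoly : DiffOp K ≃ₗ[K] K[X] := LinearEquiv.refl K K[X]

/-- The operator `f` of order zero. -/
def const (f : K) : DiffOp K := toPoly.symm (C f)

/-- The operator `∂`. -/
def del : DiffOp K := toPoly.symm X

variable [Differential K]

/-- Left multiplication by `∂`: `∂ (∑ gⱼ ∂ʲ) = ∑ gⱼ ∂ʲ⁺¹ + ∑ gⱼ′ ∂ʲ`. -/
def delAct : Module.End ℤ K[X] :=
  LinearMap.mulLeft ℤ X + (Differential.mapCoeffs (A := K)).toLinearMap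

theorem delAct_apply (Q : K[X]) : delAct Q = X * Q + Differential.mapCoeffs Q := rfl

/-- Left multiplication by `∑ fᵢ ∂ⁱ`: it sends `Q` to `∑ fᵢ (∂ⁱ Q)`. -/
def act (P : K[X]) : Module.End ℤ K[X] :=
  P.sum fun i f => LinearMap.mulLeft ℤ (C f) * delAct ^ i

theorem act_add (P Q : K[X]) : act (P + Q) = act P + act Q := by
  unfold act
  apply Polynomial.sum_add_index
  · intro i; ext; simp
  · intro i a b; ext; simp [add_mul]

theorem act_monomial (n : ℕ) (f : K) :
    act (monomial n f) = LinearMap.mulLeft ℤ (C f) * delAct ^ n := by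
  unfold act
  apply Polynomial.sum_monomial_index
  ext; simp

theorem delAct_C_mul (f : K) (Q : K[X]) :
    delAct (C f * Q) = C f * delAct Q + C (f′) * Q := by
  simp only [delAct_apply, Derivation.leibniz, Differential.mapCoeffs_C, smul_eq_mul]
  ring

/-- `act` as an additive map. -/
def actHom : K[X] →+ Module.End ℤ K[X] := AddMonoidHom.mk' act act_add

theorem actHom_apply (P : K[X]) : actHom P = act P := rfl

theorem act_C_mul (f : K) (Q : K[X]) : act (C f * Q) = LinearMap.mulLeft ℤ (C f) * act Q := by
  induction Q using Polynomial.induction_on' with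
  | add P Q hP hQ => rw [mul_add, act_add, hP, hQ, act_add, mul_add]
  | monomial n a =>
    rw [C_mul_monomial, act_monomial, act_monomial]
    ext1 x
    simp [mul_assoc]

theorem act_delAct (Q : K[X]) : act (delAct Q) = delAct * act Q := by
  induction Q using Polynomial.induction_on' with
  | add P Q hP hQ => rw [map_add, act_add, hP, hQ, act_add, mul_add]
  | monomial n a =>
    rw [delAct_apply, X_mul_monomial, Differential.mapCoeffs_monomial, act_add, act_monomial,
      act_monomial, act_monomial]
    ext1 x
    change C a * (delAct ^ (n + 1)) x
        + C (a′) * (delAct ^ n) x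
      = delAct (C a * (delAct ^ n) x)
    rw [delAct_C_mul, pow_succ']
    rfl

theorem act_delAct_pow (n : ℕ) (Q : K[X]) :
    act ((delAct ^ n) Q) = delAct ^ n * act Q := by
  induction n with
  | zero => simp
  | succ n ih =>
    rw [pow_succ', Module.End.mul_apply, act_delAct, ih, mul_assoc]

theorem act_act (P Q : K[X]) : act (act P Q) = act P * act Q := by
  induction P using Polynomial.induction_on' with
  | add P P' hP hP' => rw [act_add, LinearMap.add_apply, act_add, hP, hP', add_mul]
  | monomial n a =>
    rw [act_monomial]
    change act (C a * (delAct ^ n) Q) = _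
    rw [act_C_mul, act_delAct_pow, mul_assoc]

theorem delAct_pow_one (n : ℕ) : ((delAct : Module.End ℤ K[X]) ^ n) 1 = X ^ n := by
  induction n with
  | zero => simp
  | succ n ih =>
    rw [pow_succ', Module.End.mul_apply, ih, delAct_apply]
    have : Differential.mapCoeffs (X ^ n : K[X]) = 0 := by
      rw [Derivation.leibniz_pow, Differential.mapCoeffs_X, smul_zero, smul_zero]
    rw [this, pow_succ']
    simp

theorem act_one_right (P : K[X]) : act P 1 = P := by
  induction P using Polynomial.induction_on' with
  | add P Q hP hQ => rw [act_add, LinearMap.add_apply, hP, hQ]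
  | monomial n a =>
    rw [act_monomial]
    change C a * (delAct ^ n) 1 = _
    rw [delAct_pow_one, C_mul_X_pow_eq_monomial]

theorem act_one_left : act (1 : K[X]) = 1 := by
  have := act_monomial (K := K) 0 1
  rw [← C_mul_X_pow_eq_monomial] at this
  simp only [map_one, pow_zero, mul_one] at this
  rw [this]
  ext1 x
  simp

instance : Mul (DiffOp K) := ⟨fun P Q => toPoly.symm (act (toPoly P) (toPoly Q))⟩

instance : One (DiffOp K) := ⟨toPoly.symm 1⟩

theorem toPoly_mul (P Q : DiffOp K) : toPoly (P * Q) = act (toPoly P) (toPoly Q) := rfl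

theorem toPoly_one : toPoly (1 : DiffOp K) = 1 := rfl

instance : Ring (DiffOp K) where
  __ := (inferInstance : AddCommGroup (DiffOp K))
  left_distrib P Q R := toPoly.injective (by simp [toPoly_mul])
  right_distrib P Q R := toPoly.injective (by simp [toPoly_mul, act_add])
  zero_mul P := toPoly.injective (by
    rw [toPoly_mul, map_zero, ← actHom_apply, map_zero]; rfl)
  mul_zero P := toPoly.injective (by simp [toPoly_mul])
  mul_assoc P Q R := toPoly.injective (by simp [toPoly_mul, act_act])
  one_mul P := toPoly.injective (by simp [toPoly_mul, toPoly_one, act_one_left])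
  mul_one P := toPoly.injective (by simp [toPoly_mul, toPoly_one, act_one_right])

theorem toPoly_const_mul (f : K) (P : DiffOp K) : toPoly (const f * P) = C f * toPoly P := by
  rw [toPoly_mul]
  change act (C f) _ = _
  rw [← monomial_zero_left, act_monomial]
  simp

theorem toPoly_del_mul (P : DiffOp K) : toPoly (del * P) = delAct (toPoly P) := by
  rw [toPoly_mul]
  change act X _ = _
  rw [← monomial_one_one_eq_X, act_monomial]
  simp

theorem smul_eq_const_mul (f : K) (P : DiffOp K) : f • P = const f * P :=
  toPoly.injective (by rw [toPoly_const_mul, map_smul, smul_eq_C_mul])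

/-- The defining commutation rule `∂ f = f ∂ + f′`. -/
theorem del_mul_const (f : K) : del * const f = const f * del + const (f′) := by
  apply toPoly.injective
  rw [toPoly_del_mul, map_add, toPoly_const_mul]
  change delAct (C f) = C f * X + C (f′)
  rw [delAct_apply, Differential.mapCoeffs_C]
  ring

theorem toPoly_del_pow_mul (n : ℕ) (P : DiffOp K) :
    toPoly (del ^ n * P) = (delAct ^ n) (toPoly P) := by
  induction n with
  | zero => simp
  | succ n ih =>
    rw [pow_succ', mul_assoc, toPoly_del_mul, ih, pow_succ', Module.End.mul_apply]

/-- Every operator is `∑ fᵢ ∂ⁱ`, where the `fᵢ` are the coefficients of the polynomial. -/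
theorem eq_sum (P : DiffOp K) : P = (toPoly P).sum fun i f => const f * del ^ i := by
  apply toPoly.injective
  rw [Polynomial.sum, map_sum]
  conv_lhs => rw [(toPoly P).as_sum_support]
  refine Finset.sum_congr rfl fun i _ => ?_
  rw [toPoly_const_mul, ← mul_one (del ^ i), toPoly_del_pow_mul, toPoly_one, delAct_pow_one,
    C_mul_X_pow_eq_monomial]

instance : IsScalarTower K (DiffOp K) (DiffOp K) :=
  ⟨fun f P Q => by simp only [smul_eq_mul, smul_eq_const_mul, mul_assoc]⟩

theorem iterate_mapCoeffs_coeff (n : ℕ) (Q : K[X]) (i : ℕ) :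
    ((Differential.mapCoeffs (A := K))^[n] Q).coeff i
      = (fun f : K => f′)^[n] (Q.coeff i) := by
  induction n generalizing Q with
  | zero => rfl
  | succ n ih =>
    rw [Function.iterate_succ_apply, ih, Differential.coeff_mapCoeffs,
      Function.iterate_succ_apply]

theorem del_pow_mul_const_of_iterate (p : ℕ) [Fact p.Prime] [CharP K p]
    (h : ∀ f : K, (fun f : K => f′)^[p] f = 0) (f : K) :
    (del ^ p : DiffOp K) * const f = const f * del ^ p := by
  let E := Module.End ℤ K[X]
  let x : E := LinearMap.mulLeft ℤ X
  let d : E := (Differential.mapCoeffs (A := K)).toLinearMap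
  have : CharP E p := charP_of_injective_ringHom
    (f := Module.toModuleEnd ℤ (S := K[X]) K[X])
    (fun a b hab => by simpa using LinearMap.congr_fun hab (1 : K[X])) p
  have hcomm : Commute x d := by
    apply LinearMap.ext
    intro Q
    change X * Differential.mapCoeffs Q = Differential.mapCoeffs (X * Q)
    simp [Derivation.leibniz]
  have hiter : ∀ (n : ℕ) (Q : K[X]),
      (delAct ^ n) Q = ((x + d) ^ n) Q := by
    intro n
    induction n with
    | zero => intro Q; rfl
    | succ n ih =>
      intro Q
      rw [pow_succ', Module.End.mul_apply, ih, pow_succ', Module.End.mul_apply]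
      rfl
  have hd : ∀ Q, (d ^ p) Q = 0 := by
    intro Q
    rw [Module.End.pow_apply]
    ext i
    change ((Differential.mapCoeffs (A := K))^[p] Q).coeff i = _
    rw [iterate_mapCoeffs_coeff, h]
    simp
  have hx : ∀ (n : ℕ) Q, (x ^ n) Q = X ^ n * Q := by
    intro n
    induction n with
    | zero => intro Q; rw [pow_zero, pow_zero, one_mul]; rfl
    | succ n ih =>
      intro Q
      rw [pow_succ', Module.End.mul_apply, ih, pow_succ', mul_assoc]
      rfl
  apply toPoly.injective
  rw [toPoly_del_pow_mul, hiter, add_pow_char_of_commute _ hcomm, LinearMap.add_apply, hd, hx,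
    toPoly_const_mul, ← mul_one (del ^ p), toPoly_del_pow_mul, toPoly_one, delAct_pow_one, add_zero,
    mul_comm]
  rfl

/-! ## The quotient modules `𝒟_L` -/

/-- The left `K⟨∂⟩`-module `𝒟_L = K⟨∂⟩ / K⟨∂⟩L`. It is a `K`-vector space through `K ⊆ K⟨∂⟩`. -/
abbrev QuotModule (L : DiffOp K) : Type _ := DiffOp K ⧸ Submodule.span (DiffOp K) {L}

theorem smul_quot_eq (L : DiffOp K) (f : K) (m : QuotModule L) : f • m = const f • m := by
  obtain ⟨P, rfl⟩ := Submodule.mkQ_surjective _ m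
  change Submodule.mkQ _ (f • P) = Submodule.mkQ _ (const f * P)
  rw [smul_eq_const_mul]

/-- Two operators are equivalent if their quotient modules are isomorphic over `K⟨∂⟩`. -/
def Equivalent (L₁ L₂ : DiffOp K) : Prop :=
  Nonempty (QuotModule L₁ ≃ₗ[DiffOp K] QuotModule L₂)

end Ring

section Field

variable {K : Type*} [Field K] [Differential K]

theorem delAct_natDegree_le (Q : K[X]) (r : ℕ) (hQ : Q.degree < r) :
    (delAct Q).degree ≤ r := by
  rw [delAct_apply]
  refine (degree_add_le _ _).trans (max_le ?_ ?_)
  · rw [degree_le_iff_coeff_zero]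
    intro m hm
    have hm' : r < m := by exact_mod_cast hm
    obtain ⟨k, rfl⟩ : ∃ k, m = k + 1 := ⟨m - 1, by omega⟩
    rw [coeff_X_mul]
    exact coeff_eq_zero_of_degree_lt (hQ.trans_le (by exact_mod_cast (by omega : r ≤ k)))
  · rw [degree_le_iff_coeff_zero]
    intro m hm
    rw [Differential.coeff_mapCoeffs, coeff_eq_zero_of_degree_lt (hQ.trans hm), map_zero]

/-- For `L ≠ 0` the `K`-vector space `𝒟_L` has finite dimension. -/
theorem finite_quotModule {L : DiffOp K} (hL : L ≠ 0) : Module.Finite K (QuotModule L) := by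
  set r := (toPoly L).natDegree with hr
  have hL' : toPoly L ≠ 0 := fun h => hL (toPoly.injective (by rw [h, map_zero]))
  let π : DiffOp K →ₗ[K] QuotModule L :=
    (Submodule.mkQ (Submodule.span (DiffOp K) {L})).restrictScalars K
  let W : Submodule K (QuotModule L) :=
    ((degreeLT K r).map (toPoly (K := K)).symm.toLinearMap).map π
  have hπL : π L = 0 := (Submodule.Quotient.mk_eq_zero _).2 (Submodule.mem_span_singleton_self L)
  have key : ∀ P : DiffOp K, (toPoly P).degree ≤ r → π P ∈ W := by
    intro P hP
    set c := (toPoly P).coeff r / (toPoly L).leadingCoeff with hc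
    have h1 : π P = π (P - c • L) := by rw [map_sub, map_smul, hπL, smul_zero, sub_zero]
    rw [h1]
    refine Submodule.mem_map_of_mem ⟨toPoly (P - c • L), ?_, by simp⟩
    rw [SetLike.mem_coe, mem_degreeLT, degree_lt_iff_coeff_zero]
    intro m hm
    rcases hm.eq_or_lt with rfl | hm
    · have : (toPoly L).coeff r = (toPoly L).leadingCoeff := rfl
      rw [map_sub, map_smul, coeff_sub, coeff_smul, this, hc, smul_eq_mul,
        div_mul_cancel₀ _ (leadingCoeff_ne_zero.2 hL'), sub_self]
    · rw [map_sub, map_smul, coeff_sub, coeff_smul,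
        coeff_eq_zero_of_degree_lt (hP.trans_lt (by exact_mod_cast hm)),
        coeff_eq_zero_of_natDegree_lt hm, smul_zero, sub_zero]
  have hstab : ∀ w ∈ W, (del : DiffOp K) • w ∈ W := by
    rintro _ ⟨_, ⟨Q, hQ, rfl⟩, rfl⟩
    have : (del : DiffOp K) • π (toPoly.symm Q) = π (del * toPoly.symm Q) := rfl
    change (del : DiffOp K) • π (toPoly.symm Q) ∈ W
    rw [this]
    apply key
    rw [toPoly_del_mul, LinearEquiv.apply_symm_apply]
    exact delAct_natDegree_le Q r (mem_degreeLT.1 hQ)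
  have hpow : ∀ n : ℕ, π (del ^ n) ∈ W := by
    intro n
    induction n with
    | zero =>
      rw [pow_zero]
      apply key
      rw [toPoly_one, degree_one]
      exact_mod_cast Nat.zero_le r
    | succ n ih =>
      rw [pow_succ']
      exact hstab _ ih
  have htop : W = ⊤ := by
    rw [eq_top_iff]
    rintro w -
    obtain ⟨P, rfl⟩ := Submodule.mkQ_surjective _ w
    change π P ∈ W
    rw [eq_sum P, Polynomial.sum, map_sum]
    refine Submodule.sum_mem _ fun i _ => ?_
    rw [← smul_eq_const_mul, map_smul]
    exact W.smul_mem _ (hpow i)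
  have : Module.Finite K (degreeLT K r) := Module.Finite.equiv (degreeLTEquiv K r).symm
  have hfg : W.FG :=
    ((Module.Finite.iff_fg.1 ‹Module.Finite K (degreeLT K r)›).map _).map _
  exact ⟨htop ▸ hfg⟩

end Field

/-! ## The `p`-curvature -/

section PCurvature

variable {F : Type*} [Field F]

/-- In characteristic `p`, `∂ᵖ` commutes with all elements of `F(t)`. -/
theorem del_pow_char_mul_const (p : ℕ) [Fact p.Prime] [CharP F p] (f : RatFunc F) :
    (del ^ p : DiffOp (RatFunc F)) * const f = const f * del ^ p := by
  have : CharP (RatFunc F) p := charP_of_injective_algebraMap (algebraMap F (RatFunc F)).injective p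
  exact del_pow_mul_const_of_iterate p (RatFunc.iterate_deriv_char p) f

/-- The `p`-curvature of `L`: the `F(t)`-linear endomorphism of `𝒟_L` given by the (left)
multiplication by `∂ᵖ`. -/
def pCurvature (p : ℕ) [Fact p.Prime] [CharP F p] (L : DiffOp (RatFunc F)) :
    Module.End (RatFunc F) (QuotModule L) where
  toFun m := (del ^ p : DiffOp (RatFunc F)) • m
  map_add' := smul_add _
  map_smul' f m := by
    rw [smul_quot_eq, RingHom.id_apply, smul_quot_eq, ← mul_smul, del_pow_char_mul_const, mul_smul]

/-- The characteristic polynomial `χ(ψ_p^L)` of the `p`-curvature of a nonzero operator `L`. -/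
def pCurvatureCharpoly (p : ℕ) [Fact p.Prime] [CharP F p] (L : DiffOp (RatFunc F)) (hL : L ≠ 0) :
    (RatFunc F)[X] :=
  haveI := finite_quotModule hL
  (pCurvature p L).charpoly

/-- The subfield `F(tᵖ)` of `F(t)`. -/
abbrev powSubfield (F : Type*) [Field F] (p : ℕ) : IntermediateField F (RatFunc F) :=
  IntermediateField.adjoin F {(RatFunc.X : RatFunc F) ^ p}

/-- The separability hypothesis: no irreducible polynomial over `F(tᵖ)` which divides the
characteristic polynomial of the `p`-curvature of `L` is inseparable. -/
def SeparabilityHypothesis (p : ℕ) [Fact p.Prime] [CharP F p] (L : DiffOp (RatFunc F))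
    (hL : L ≠ 0) : Prop :=
  ∀ N : (powSubfield F p)[X], Irreducible N →
    N.map (algebraMap (powSubfield F p) (RatFunc F)) ∣ pCurvatureCharpoly p L hL → N.Separable

end PCurvature

end DiffOp

/-- Two endomorphisms `φ` of `V` and `ψ` of `W` are equivalent (similar) if a linear isomorphism
`V → W` carries one to the other. -/
def EquivalentEnd {K V W : Type*} [Field K] [AddCommGroup V] [Module K V] [AddCommGroup W]
    [Module K W] (φ : Module.End K V) (ψ : Module.End K W) : Prop :=
  ∃ e : V ≃ₗ[K] W, ∀ v, e (φ v) = ψ (e v)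

end

/-!
An isomorphism of left `K⟨∂⟩`-modules is linear over `K` and commutes with `∂ᵖ`, which is one
direction. For the other, let `e : M ≃ N` be a `K`-linear isomorphism commuting with `∂ᵖ`. The space
`Hom_K(M, N)` is itself a differential module, with `δ φ = ∂ ∘ φ - φ ∘ ∂`
(`DiffOp.delCommutator`), and its horizontal elements are the `K⟨∂⟩`-linear maps. In characteristic
`p` one has `δᵖ φ = ∂ᵖ ∘ φ - φ ∘ ∂ᵖ` (`DiffOp.iterate_delCommutator_char`), so `δᵖ e = 0`. By the
argument of Cartier's theorem, an element killed by `δᵖ` is a `K`-linear combination of horizontal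
elements (`Differential.mem_span_horizontal`), because `K` contains an element `t` with `t′ = 1`.
Hence `e = ∑ xⱼ φⱼ` with `xⱼ ∈ K` and `φⱼ` linear over `K⟨∂⟩`.

The determinant of `e⁻¹ ∘ ∑ Xⱼ φⱼ` is a polynomial over `K` in the `Xⱼ` which does not vanish at
`x`. As the field of constants is infinite, it does not vanish at some point `c` with constant
coordinates either (`exists_isUnit_sum_smul`); then `∑ cⱼ φⱼ` is bijective and linear over
`K⟨∂⟩`.
-/

noncomputable section

/-! ### Horizontal elements of differential modules -/

namespace Differential

section Cartier

variable {K V : Type*} [Field K] [Differential K] [AddCommGroup V] [Module K V]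

theorem iterate_pow_smul_horizontal {δ : V →+ V}
    (hδ : ∀ (f : K) (x : V), δ (f • x) = f′ • x + f • δ x) {t : K} (ht : t′ = 1) (k : ℕ) {y : V}
    (hy : δ y = 0) : δ^[k] (t ^ k • y) = (k.factorial : K) • y := by
  induction k generalizing y with
  | zero => simp
  | succ k ih =>
    have hk : δ (t ^ (k + 1) • y) = t ^ k • (k + 1) • y := by
      rw [hδ, hy, smul_zero, add_zero, Derivation.leibniz_pow, ht, ← Nat.cast_smul_eq_nsmul K,
        ← Nat.cast_smul_eq_nsmul K, smul_smul, Nat.add_sub_cancel, smul_eq_mul, mul_one,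
        mul_comm, mul_smul]
    rw [Function.iterate_succ_apply, hk, ih (by rw [map_nsmul, hy, smul_zero]),
      ← Nat.cast_smul_eq_nsmul K, smul_smul, Nat.factorial_succ, Nat.cast_mul, mul_comm]

/-- The spanning part of Cartier's theorem: in a differential module `(V, δ)` in characteristic `p`,
an element killed by a power `δⁿ` with `n ≤ p` is a linear combination of horizontal elements. -/
theorem mem_span_horizontal {δ : V →+ V}
    (hδ : ∀ (f : K) (x : V), δ (f • x) = f′ • x + f • δ x) {t : K} (ht : t′ = 1)
    (p : ℕ) [Fact p.Prime] [CharP K p] {n : ℕ} (hn : n ≤ p) {x : V} (hx : δ^[n] x = 0) :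
    x ∈ Submodule.span K {y | δ y = 0} := by
  induction n generalizing x with
  | zero =>
    rw [Function.iterate_zero_apply] at hx
    rw [hx]
    exact zero_mem _
  | succ n ih =>
    have hfac : (n.factorial : K) ≠ 0 := by
      rw [Ne, CharP.cast_eq_zero_iff K p, (Fact.out : p.Prime).dvd_factorial]
      omega
    -- Subtracting `tⁿ / n! • δⁿ x`, where `δⁿ x` is horizontal, lowers the order of nilpotency.
    set y := δ^[n] x with hy
    have hδy : δ y = 0 := by rw [hy, ← Function.iterate_succ_apply' δ, hx]
    have hδz : δ ((n.factorial : K)⁻¹ • y) = 0 := by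
      have h1 : ((n.factorial : K)⁻¹)′ = 0 := by
        rw [Derivation.leibniz_inv, Derivation.map_natCast, smul_zero]
      rw [hδ, hδy, h1, zero_smul, smul_zero, add_zero]
    have hsub : x - t ^ n • (n.factorial : K)⁻¹ • y ∈ Submodule.span K {y | δ y = 0} := by
      refine ih (by omega) ?_
      rw [iterate_map_sub, ← hy, iterate_pow_smul_horizontal hδ ht n hδz, smul_inv_smul₀ hfac,
        sub_self]
    have := add_mem hsub
      (Submodule.smul_mem _ (t ^ n) (Submodule.subset_span (s := {y | δ y = 0}) hδz))
    rwa [sub_add_cancel] at this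

end Cartier

/-- In positive characteristic the constants of an infinite differential field form an infinite
set, as they contain all `p`-th powers. -/
theorem infinite_setOf_deriv_eq_zero (K : Type*) [Field K] [Differential K] [Infinite K] (p : ℕ)
    [Fact p.Prime] [CharP K p] : {c : K | c′ = 0}.Infinite := by
  refine (Set.infinite_range_of_injective (frobenius_inj K p)).mono ?_
  rintro _ ⟨x, rfl⟩
  rw [Set.mem_ofPred_eq, frobenius_def, Derivation.leibniz_pow, ← Nat.cast_smul_eq_nsmul K,
    CharP.cast_eq_zero, zero_smul]

end Differential

/-! ### Specializing the coefficients of an invertible linear combination -/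

/-- If some linear combination of the endomorphisms `aᵢ` is invertible, then so is one with
coefficients in any given infinite subset of the field. -/
theorem exists_isUnit_sum_smul {K V ι : Type*} [Field K] [AddCommGroup V] [Module K V]
    [Module.Finite K V] [Fintype ι] {S : Set K} (hS : S.Infinite) (a : ι → Module.End K V)
    {x : ι → K} (hx : IsUnit (∑ i, x i • a i)) :
    ∃ c : ι → K, (∀ i, c i ∈ S) ∧ IsUnit (∑ i, c i • a i) := by
  let b := Module.finBasis K V
  let P : MvPolynomial ι K :=
    (∑ i, (MvPolynomial.X i : MvPolynomial ι K) •
      (LinearMap.toMatrix b b (a i)).map MvPolynomial.C).det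
  have hP : ∀ c : ι → K, MvPolynomial.eval c P = LinearMap.det (∑ i, c i • a i) := by
    intro c
    rw [RingHom.map_det, ← LinearMap.det_toMatrix b, map_sum, map_sum]
    congr 1
    refine Finset.sum_congr rfl fun i _ => ?_
    ext k l
    simp
  have hP0 : P ≠ 0 := by
    intro h
    have := hP x
    rw [h, map_zero] at this
    exact ((LinearMap.isUnit_iff_isUnit_det _).1 hx).ne_zero this.symm
  by_contra! hc
  refine hP0 (MvPolynomial.funext_set (fun _ => S) (fun _ => hS) fun c hcS => ?_)
  rw [hP, map_zero]
  by_contra h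
  exact hc c (fun i => hcS i trivial)
    ((LinearMap.isUnit_iff_isUnit_det _).2 (isUnit_iff_ne_zero.2 h))

/-! ### Homomorphisms of `K⟨∂⟩`-modules as horizontal linear maps -/

namespace DiffOp

section Hom

variable {K M N : Type*} [Field K] [Differential K]
  [AddCommGroup M] [Module K M] [Module (DiffOp K) M] [IsScalarTower K (DiffOp K) M]
  [AddCommGroup N] [Module K N] [Module (DiffOp K) N] [IsScalarTower K (DiffOp K) N]

theorem const_smul (f : K) (m : M) : const f • m = f • m := by
  rw [← mul_one (const f), ← smul_eq_const_mul, smul_assoc, one_smul]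

theorem del_smul_smul (f : K) (m : M) :
    (del : DiffOp K) • f • m = f • (del : DiffOp K) • m + f′ • m := by
  rw [← const_smul f m, ← mul_smul, del_mul_const, add_smul, mul_smul, const_smul, const_smul]

/-- A `K`-linear map that commutes with `∂`, as a homomorphism of left `K⟨∂⟩`-modules. -/
def linearMapOfCommDel (φ : M →ₗ[K] N)
    (h : ∀ m, φ ((del : DiffOp K) • m) = (del : DiffOp K) • φ m) : M →ₗ[DiffOp K] N where
  toFun := φ
  map_add' := map_add φ
  map_smul' P m := by
    have hpow : ∀ (i : ℕ) (m : M), φ ((del ^ i : DiffOp K) • m) = (del ^ i : DiffOp K) • φ m := by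
      intro i
      induction i with
      | zero => simp
      | succ i ih => intro m; rw [pow_succ', mul_smul, h, ih, mul_smul]
    rw [RingHom.id_apply, eq_sum P, Polynomial.sum, Finset.sum_smul, Finset.sum_smul, map_sum]
    refine Finset.sum_congr rfl fun i _ => ?_
    rw [mul_smul, mul_smul, const_smul, const_smul, map_smul, hpow]

variable (M N) in
/-- The connection `φ ↦ ∂ ∘ φ - φ ∘ ∂` on the space of `K`-linear maps between two left
`K⟨∂⟩`-modules. -/
def delCommutator : (M →ₗ[K] N) →+ (M →ₗ[K] N) where
  toFun φ :=
    { toFun := fun m => (del : DiffOp K) • φ m - φ ((del : DiffOp K) • m)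
      map_add' := fun m m' => by simp only [map_add, smul_add]; abel
      map_smul' := fun f m => by
        rw [map_smul, del_smul_smul, del_smul_smul, map_add, map_smul φ, map_smul φ,
          RingHom.id_apply, smul_sub]
        abel }
  map_zero' := by ext; simp
  map_add' φ ψ := by
    ext m
    simp only [LinearMap.add_apply, LinearMap.coe_mk, AddHom.coe_mk, smul_add]
    abel

theorem delCommutator_apply (φ : M →ₗ[K] N) (m : M) :
    delCommutator M N φ m = (del : DiffOp K) • φ m - φ ((del : DiffOp K) • m) := rfl

theorem delCommutator_smul (f : K) (φ : M →ₗ[K] N) :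
    delCommutator M N (f • φ) = f′ • φ + f • delCommutator M N φ := by
  ext m
  simp only [delCommutator_apply, LinearMap.smul_apply, LinearMap.add_apply, del_smul_smul,
    smul_sub]
  abel

/-- Jacobson's formula for the connection on `Hom_K(M, N)`: composition with `∂` on the left and on
the right commute, so the cross terms of the `p`-th power of their difference vanish. -/
theorem iterate_delCommutator_char (p : ℕ) [Fact p.Prime] [CharP K p] (φ : M →ₗ[K] N) (m : M) :
    (delCommutator M N)^[p] φ m
      = (del ^ p : DiffOp K) • φ m - φ ((del ^ p : DiffOp K) • m) := by
  -- Composition with `∂` does not preserve `K`-linearity, so it is taken on all additive maps.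
  let A := M →+ N
  let l : AddMonoid.End A := AddMonoidHom.compHom (DistribSMul.toAddMonoidHom N (del : DiffOp K))
  let r : AddMonoid.End A := AddMonoidHom.compHom.flip
    (DistribSMul.toAddMonoidHom M (del : DiffOp K))
  have hl : ∀ (n : ℕ) (ψ : A) (m : M), (l ^ n) ψ m = (del ^ n : DiffOp K) • ψ m := by
    intro n
    induction n with
    | zero => intro ψ m; simp
    | succ n ih =>
      intro ψ m
      rw [pow_succ]
      change (l ^ n) (l ψ) m = _
      rw [ih, pow_succ, mul_smul]
      rfl
  have hr : ∀ (n : ℕ) (ψ : A) (m : M), (r ^ n) ψ m = ψ ((del ^ n : DiffOp K) • m) := by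
    intro n
    induction n with
    | zero => intro ψ m; simp
    | succ n ih =>
      intro ψ m
      rw [pow_succ]
      change (r ^ n) (r ψ) m = _
      rw [ih, pow_succ', mul_smul]
      rfl
  have hcomm : Commute l (-r) := by
    refine Commute.neg_right ?_
    ext ψ m
    rfl
  have hiter : ∀ n : ℕ,
      ((delCommutator M N)^[n] φ).toAddMonoidHom = ((l + -r) ^ n) φ.toAddMonoidHom := by
    intro n
    induction n with
    | zero => rfl
    | succ n ih =>
      rw [Function.iterate_succ_apply', pow_succ']
      change _ = (l + -r) (((l + -r) ^ n) φ.toAddMonoidHom)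
      rw [← ih]
      ext m
      exact sub_eq_add_neg _ _
  have hneg : ((-r) ^ p) φ.toAddMonoidHom m = -(φ ((del ^ p : DiffOp K) • m)) := by
    rcases (Fact.out : p.Prime).eq_two_or_odd' with rfl | hodd
    · -- In characteristic two the sign disappears.
      have h2 : ∀ n : N, -n = n := fun n => by
        rw [← neg_one_smul K n, CharTwo.neg_eq, one_smul]
      rw [h2, neg_sq, hr]
      rfl
    · rw [hodd.neg_pow]
      change -((r ^ p) φ.toAddMonoidHom m) = _
      rw [hr]
      rfl
  obtain ⟨s, hs⟩ := hcomm.exists_add_pow_prime_eq (Fact.out : p.Prime)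
  have hps : ∀ (s' : AddMonoid.End A) (ψ : A), ((p : AddMonoid.End A) * s') ψ = 0 := by
    intro s' ψ
    ext m
    change (p : AddMonoid.End A) (s' ψ) m = 0
    rw [AddMonoid.End.natCast_apply, AddMonoidHom.nsmul_apply, ← Nat.cast_smul_eq_nsmul K,
      CharP.cast_eq_zero, zero_smul]
  have := DFunLike.congr_fun (hiter p) m
  rw [hs, mul_assoc, mul_assoc] at this
  change _ = (l ^ p) φ.toAddMonoidHom m + ((-r) ^ p) φ.toAddMonoidHom m
    + ((p : AddMonoid.End A) * (l * (-r * s))) φ.toAddMonoidHom m at this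
  rw [hps, hl, hneg] at this
  refine this.trans ?_
  rw [AddMonoidHom.zero_apply, add_zero, ← sub_eq_add_neg]
  rfl

/-- Left `K⟨∂⟩`-modules of finite dimension over `K` are isomorphic as soon as there is a `K`-linear
isomorphism between them that commutes with `∂ᵖ`. -/
theorem nonempty_linearEquiv_of_comm_del_pow [Infinite K] [Module.Finite K M] (p : ℕ)
    [Fact p.Prime] [CharP K p] {t : K} (ht : t′ = 1) (e : M ≃ₗ[K] N)
    (he : ∀ m, e ((del ^ p : DiffOp K) • m) = (del ^ p : DiffOp K) • e m) :
    Nonempty (M ≃ₗ[DiffOp K] N) := by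
  have hspan : (e : M →ₗ[K] N) ∈ Submodule.span K {φ | delCommutator M N φ = 0} := by
    refine Differential.mem_span_horizontal delCommutator_smul ht p le_rfl ?_
    ext m
    rw [iterate_delCommutator_char, LinearEquiv.coe_coe, he, sub_self, LinearMap.zero_apply]
  obtain ⟨n, x, φ, hφ⟩ := Submodule.mem_span_set'.1 hspan
  have hx : IsUnit (∑ i, x i • ((e.symm : N →ₗ[K] M) ∘ₗ (φ i : M →ₗ[K] N) : Module.End K M)) := by
    have : ∑ i, x i • ((e.symm : N →ₗ[K] M) ∘ₗ (φ i : M →ₗ[K] N) : Module.End K M) = 1 := by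
      ext m
      simpa [LinearMap.sum_apply] using congrArg e.symm (LinearMap.congr_fun hφ m)
    rw [this]
    exact isUnit_one
  obtain ⟨c, hc, hunit⟩ :=
    exists_isUnit_sum_smul (Differential.infinite_setOf_deriv_eq_zero K p) _ hx
  set ψ : M →ₗ[K] N := ∑ i, c i • (φ i : M →ₗ[K] N) with hψ
  have hbij : Function.Bijective ψ := by
    have h1 : ∑ i, c i • ((e.symm : N →ₗ[K] M) ∘ₗ (φ i : M →ₗ[K] N) : Module.End K M)
        = (e.symm : N →ₗ[K] M) ∘ₗ ψ := by
      ext m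
      simp [hψ]
    rw [h1, Module.End.isUnit_iff, LinearMap.coe_comp, LinearEquiv.coe_coe] at hunit
    exact (Function.Bijective.of_comp_iff' e.symm.bijective ψ).1 hunit
  have hhor : delCommutator M N ψ = 0 := by
    rw [hψ, map_sum]
    refine Finset.sum_eq_zero fun i _ => ?_
    rw [delCommutator_smul, (φ i).2, hc i, zero_smul, smul_zero, add_zero]
  have hcomm : ∀ m, ψ ((del : DiffOp K) • m) = (del : DiffOp K) • ψ m := fun m =>
    (sub_eq_zero.1 (LinearMap.congr_fun hhor m)).symm
  exact ⟨LinearEquiv.ofBijective (linearMapOfCommDel ψ hcomm) hbij⟩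

end Hom

end DiffOp

end

theorem RatFunc.deriv_X {F : Type*} [Field F] : (RatFunc.X : RatFunc F)′ = 1 := by
  rw [← RatFunc.algebraMap_X, RatFunc.deriv_algebraMap_poly, derivative_X, map_one]

theorem mainTheorem3 (p : ℕ) [Fact p.Prime] (F : Type*) [Field F] [Finite F] [CharP F p]
    (L₁ L₂ : DiffOp (RatFunc F)) (h₁ : L₁ ≠ 0) (h₂ : L₂ ≠ 0)
    (hs₁ : DiffOp.SeparabilityHypothesis p L₁ h₁)
    (hs₂ : DiffOp.SeparabilityHypothesis p L₂ h₂) :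
    DiffOp.Equivalent L₁ L₂ ↔
      EquivalentEnd (DiffOp.pCurvature p L₁) (DiffOp.pCurvature p L₂) := by
  constructor
  · rintro ⟨e⟩
    refine ⟨{ e with
      map_smul' := fun f m => ?_ }, fun m => e.map_smul _ m⟩
    change e (f • m) = f • e m
    rw [DiffOp.smul_quot_eq, map_smul, DiffOp.smul_quot_eq]
  · rintro ⟨e, he⟩
    have : CharP (RatFunc F) p :=
      charP_of_injective_algebraMap (algebraMap F (RatFunc F)).injective p
    have : Infinite (RatFunc F) := Infinite.of_injective _ (RatFunc.algebraMap_injective F)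
    have := DiffOp.finite_quotModule h₁
    exact DiffOp.nonempty_linearEquiv_of_comm_del_pow p RatFunc.deriv_X e he
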